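/- Let $d\ge 2$, let $\sigma$ be the $(d-1)$-dimensional Hausdorff measure on $\mathbb{R}^d$, and let $S\subset\mathbb{R}^d$ be a closed Lipschitz surface, that is, a closed set such that every $x_0\in S$ has a neighbourhood in which, in a suitable Cartesian coordinate system, $S$ is the graph of a Lipschitz function of $d-1$ variables (for example, the boundary of a bounded Lipschitz domain). Assume that $S$ is non-resonant with respect to $\mathbb{Z}^d$: $$\sigma\big(\{x\in S:\ n(x)\text{ is well-defined and } n(x)\in\mathbb{R}\mathbb{Z}^d\}\big)=0,$$ where $n(x)$ is the unit normal to $S$ at $x$, i.e. the unit vector, unique up to sign, with $n(x)\cdot(y-x)=o(|y-x|)$ as $y\to x$ in $S$, if there is one, and $\mathbb{R}\mathbb{Z}^d=\{tk: t\in\mathbb{R},\,k\in\mathbb{Z}^d\}$. Let $g$ be a continuous (real- or complex-valued) function on $\mathbb{T}^d=\mathbb{R}^d/\mathbb{Z}^d$, regarded also as a $1$-periodic function on $\mathbb{R}^d$, let $\langle g\rangle=\int_{\mathbb{T}^d}g(y)\,dy$, and let $f\in L^1(S,\sigma)$. Then $$\lim_{\lambda\to\infty}\int_S g(\lambda x)f(x)\,d\sigma(x)=\langle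 g\rangle\int_S f(x)\,d\sigma(x).$$ -/

import Mathlib

open MeasureTheory Filter Topology Set
open scoped NNReal RealInnerProductSpace

noncomputable section

/-- The surface measure `σ` of hypersurfaces in `ℝᵈ`: the `(d - 1)`-dimensional Hausdorff measure,
normalised so that it is Lebesgue measure on hyperplanes. Only used for `d ≥ 1`. -/
def surfaceMeasure (d : ℕ) : Measure (EuclideanSpace ℝ (Fin d)) :=
  Measure.euclideanHausdorffMeasure (d - 1)

/-- `S ⊆ ℝᵈ` is a Lipschitz (hyper)surface without boundary: near each of its points, `S` coincides
with the graph of a Lipschitz function in a suitable Cartesian coordinate system. Here `ν` is the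
direction of the last coordinate axis, and the orthogonal complement of `ν` carries the first
`d - 1` coordinates. -/
def IsLipschitzSurface {d : ℕ} (S : Set (EuclideanSpace ℝ (Fin d))) : Prop :=
  ∀ x ∈ S, ∃ ν : EuclideanSpace ℝ (Fin d), ‖ν‖ = 1 ∧
    ∃ (K : ℝ≥0) (φ : (ℝ ∙ ν)ᗮ → ℝ), LipschitzWith K φ ∧
      ∃ r : ℝ, 0 < r ∧ ∀ y ∈ Metric.ball x r,
        (y ∈ S ↔ ⟪ν, y⟫ = φ ((ℝ ∙ ν)ᗮ.orthogonalProjectionOnto y))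

/-- `n` is a unit normal to `S` at `x`: the hyperplane through `x` orthogonal to the unit vector `n`
is tangent to `S` at `x`, i.e. `n · (y - x) = o(|y - x|)` as `y → x` within `S`.
If `S` is near `x` the graph of a Lipschitz function `φ`, such an `n` exists exactly when `φ` is
differentiable at the base point `x'` of `x`, and then `n = ±(∇φ(x'), -1) / √(1 + |∇φ(x')|²)`. -/
def IsUnitNormalAt {d : ℕ} (S : Set (EuclideanSpace ℝ (Fin d))) (x n : EuclideanSpace ℝ (Fin d)) :
    Prop :=
  ‖n‖ = 1 ∧ (fun y => ⟪n, y - x⟫) =o[𝓝[S] x] (fun y => y - x)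

/-- A vector is rational if it lies in `ℝℤᵈ`, i.e. is a real multiple of an integer vector. -/
def IsRationalVector {d : ℕ} (a : EuclideanSpace ℝ (Fin d)) : Prop :=
  ∃ (t : ℝ) (k : Fin d → ℤ), ∀ i, a i = t * (k i : ℝ)

/-- The non-resonance condition with respect to `ℤᵈ`: the points of `S` at which the unit normal is
well defined and rational form a `σ`-null set. The sign of the normal is irrelevant. -/
def IsNonResonant {d : ℕ} (S : Set (EuclideanSpace ℝ (Fin d))) : Prop :=
  surfaceMeasure d {x ∈ S | ∃ n, IsUnitNormalAt S x n ∧ IsRationalVector n} = 0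

/-- The projection `ℝᵈ → 𝕋ᵈ = ℝᵈ / ℤᵈ`. -/
def toTorus {d : ℕ} (x : EuclideanSpace ℝ (Fin d)) : UnitAddTorus (Fin d) :=
  fun i => ((x i : ℝ) : UnitAddCircle)

end

open scoped FourierTransform

/-! By density of trigonometric polynomials in `C(𝕋ᵈ)` and of simple functions in `L¹`, it suffices
to take `g` a character `k` and `f` an indicator of a set of finite measure. For `k = 0` the claim
is trivial. For `k ≠ 0` the integral is the characteristic function, at frequency `λ`, of the image
under `x ↦ k · x` of a finite piece of `σ` on `S`; if that image is absolutely continuous,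
Riemann–Lebesgue gives the limit `0`.

Absolute continuity is where non-resonance enters. In a graph chart `Φ`, the function `H = k · Φ` is
Lipschitz, so for a null set `N` its differential vanishes at almost every point of `H⁻¹(N)`. Where
it vanishes, `k` is normal to `S`, which non-resonance allows only on a null set. The vanishing
reduces by Fubini to functions of one variable. -/

/-! ### Derivatives on preimages of null sets -/

/-- A real function has zero derivative at almost every point of the preimage of a null set. -/
theorem ae_deriv_eq_zero_of_mem_null (u : ℝ → ℝ) {N : Set ℝ} (hN : volume N = 0) :
    ∀ᵐ t, u t ∈ N → deriv u t = 0 := by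
  -- Points of `u⁻¹(N)` with nonzero derivative lie in some `A n`. On short pieces of `A n` the
  -- inverse of `u` is `(n + 1)`-Lipschitz, so a null image forces a null piece.
  set A : ℕ → Set ℝ := fun n => {t | u t ∈ N ∧ ∀ s, |s - t| < 1 / (n + 1 : ℝ) →
    |s - t| ≤ (n + 1 : ℝ) * |u s - u t|} with hA
  have hA0 : ∀ n, volume (A n) = 0 := by
    intro n
    refine measure_null_of_locally_null _ fun x hx => ?_
    set P : Set ℝ := A n ∩ Metric.ball x (1 / (2 * (n + 1 : ℝ))) with hP
    refine ⟨P, inter_mem_nhdsWithin _ (Metric.ball_mem_nhds _ (by positivity)), ?_⟩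
    have hanti : AntilipschitzWith (n + 1 : ℝ≥0) (P.domRestrict u) := by
      refine AntilipschitzWith.of_le_mul_dist fun s t => ?_
      have hs := s.2.2
      have ht := t.2.2
      rw [Metric.mem_ball] at hs ht
      have hst : dist (s : ℝ) t < 1 / (n + 1 : ℝ) := by
        have h2 : 1 / (n + 1 : ℝ) = 1 / (2 * (n + 1 : ℝ)) + 1 / (2 * (n + 1 : ℝ)) := by
          field_simp; norm_num
        rw [h2]
        exact (dist_triangle_right _ _ x).trans_lt (add_lt_add hs ht)
      simpa [Subtype.dist_eq, Real.dist_eq, Set.domRestrict] using t.2.1.2 s (by rwa [Real.dist_eq] at hst)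
    have h1 := hanti.le_hausdorffMeasure_image (d := 1) zero_le_one univ
    have h2 : (Measure.hausdorffMeasure 1 : Measure ℝ) (P.domRestrict u '' univ) = 0 := by
      rw [hausdorffMeasure_real]
      refine measure_mono_null ?_ hN
      rintro _ ⟨t, -, rfl⟩
      exact t.2.1.1
    rw [h2, mul_zero] at h1
    have h3 := isometry_subtype_coe.hausdorffMeasure_image (f := ((↑) : P → ℝ)) (d := 1)
      (Or.inl zero_le_one) univ
    rw [← hausdorffMeasure_real, ← Subtype.coe_image_univ P, h3]
    exact le_antisymm h1 zero_le
  rw [ae_iff]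
  refine measure_mono_null (fun t ht => ?_) (measure_iUnion_null hA0)
  simp only [mem_ofPred_eq, Classical.not_imp] at ht
  obtain ⟨htN, hd⟩ := ht
  have hder := (differentiableAt_of_deriv_ne_zero hd).hasDerivAt
  have hlo := (hasDerivAt_iff_isLittleO.1 hder).def (c := |deriv u t| / 2)
    (by have := abs_pos.2 hd; positivity)
  obtain ⟨ε, hε, hb⟩ := Metric.eventually_nhds_iff.1 hlo
  have hc : 0 < |deriv u t| / 2 := by have := abs_pos.2 hd; positivity
  -- The first bound puts the scale `1 / (n + 1)` below `ε`; the second makes the slope `|deriv u t|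
  -- / 2` at least `1 / (n + 1)`.
  obtain ⟨n, hn⟩ := exists_nat_gt (max (1 / ε) (1 / (|deriv u t| / 2)))
  refine mem_iUnion.2 ⟨n, htN, fun s hs => ?_⟩
  have h1 : 1 / ε < (n + 1 : ℝ) := ((le_max_left _ _).trans_lt hn).trans (lt_add_one _)
  have h2 : 1 / (|deriv u t| / 2) < (n + 1 : ℝ) :=
    ((le_max_right _ _).trans_lt hn).trans (lt_add_one _)
  have h3 : 1 / (n + 1 : ℝ) < ε := (one_div_lt hε (by positivity)).1 h1
  have h4 := hb (y := s) (by rw [Real.dist_eq]; exact hs.trans h3)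
  simp only [Real.norm_eq_abs, smul_eq_mul] at h4
  have h5 : |s - t| * |deriv u t| ≤ |u s - u t| + |deriv u t| / 2 * |s - t| := by
    rw [← abs_mul]
    calc |(s - t) * deriv u t| = |(u s - u t) - (u s - u t - (s - t) * deriv u t)| := by
          congr 1; ring
      _ ≤ _ := (abs_sub _ _).trans (by gcongr)
  have h6 : 1 ≤ (n + 1 : ℝ) * (|deriv u t| / 2) := ((div_lt_iff₀ hc).1 h2).le
  nlinarith [abs_nonneg (s - t)]

/-- A Lipschitz function has zero differential at almost every point of the preimage of a
null set. -/
theorem LipschitzWith.ae_hasFDerivAt_zero_of_mem_null {E : Type*} [NormedAddCommGroup E]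
    [NormedSpace ℝ E] [FiniteDimensional ℝ E] [MeasurableSpace E] [BorelSpace E] (μ : Measure E)
    [μ.IsAddHaarMeasure] {H : E → ℝ} {C : ℝ≥0} (hH : LipschitzWith C H) {N : Set ℝ}
    (hN : volume N = 0) :
    ∀ᵐ v ∂μ, H v ∈ N → HasFDerivAt H (0 : E →L[ℝ] ℝ) v := by
  have key : ∀ w : E, ∀ᵐ v ∂μ, lineDeriv ℝ H v w = 0 ∨ H v ∉ toMeasurable volume N := by
    intro w
    -- Fubini over the lines parallel to `w`. It needs a measurable set, hence the measurable hull
    -- of `N`.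
    refine ae_mem_of_ae_add_linearMap_mem (LinearMap.toSpanSingleton ℝ E w) volume μ
      (s := {v | lineDeriv ℝ H v w = 0 ∨ H v ∉ toMeasurable volume N}) ?_ fun y => ?_
    · exact (measurable_lineDeriv hH.continuous (measurableSet_singleton 0)).union
        (hH.continuous.measurable (measurableSet_toMeasurable _ _)).compl
    · filter_upwards [ae_deriv_eq_zero_of_mem_null (fun t : ℝ => H (y + t • w))
        (N := toMeasurable volume N) (by rwa [measure_toMeasurable])] with t ht
      by_cases hmem : H (y + t • w) ∈ toMeasurable volume N
      · left
        have h1 : (fun s : ℝ => H (y + t • w + s • w)) =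
            fun s => (fun t : ℝ => H (y + t • w)) (t + s) := by
          ext s; rw [add_assoc, ← add_smul]
        change deriv (fun s : ℝ => H (y + t • w + s • w)) 0 = 0
        rw [h1, deriv_comp_const_add (fun t : ℝ => H (y + t • w)) t 0, add_zero]
        exact ht hmem
      · exact Or.inr hmem
  have hall : ∀ᵐ v ∂μ, ∀ i, lineDeriv ℝ H v (Module.finBasis ℝ E i) = 0 ∨
      H v ∉ toMeasurable volume N := ae_all_iff.2 fun i => key _
  filter_upwards [hall, hH.ae_differentiableAt (μ := μ)] with v hv hd hmem
  have h0 : fderiv ℝ H v = 0 := by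
    apply ContinuousLinearMap.coe_injective
    refine (Module.finBasis ℝ E).ext fun i => ?_
    have := (hv i).resolve_right (not_not.2 (subset_toMeasurable _ _ hmem))
    rw [hd.lineDeriv_eq_fderiv] at this
    simpa using this
  rw [← h0]
  exact hd.hasFDerivAt

/-! ### Linear forms on a non-resonant surface -/

/-- The points of a non-resonant Lipschitz surface at which a rational linear form takes values in
a null set form a `σ`-null set. -/
theorem IsNonResonant.surfaceMeasure_inter_inner_preimage {d : ℕ}
    {S : Set (EuclideanSpace ℝ (Fin d))} (hS : IsLipschitzSurface S) (hnr : IsNonResonant S)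
    {a : EuclideanSpace ℝ (Fin d)} (ha : IsRationalVector a) (ha0 : a ≠ 0) {N : Set ℝ}
    (hN : volume N = 0) : surfaceMeasure d (S ∩ {x | ⟪a, x⟫ ∈ N}) = 0 := by
  refine measure_null_of_locally_null _ fun x hx => ?_
  obtain ⟨ν, hν, K, φ, hφ, r, hr, hgraph⟩ := hS x hx.1
  refine ⟨_, inter_mem_nhdsWithin _ (Metric.ball_mem_nhds x hr), ?_⟩
  have hν0 : ν ≠ 0 := fun h => by simp [h] at hν
  have hfin : Module.finrank ℝ (ℝ ∙ ν)ᗮ = d - 1 := by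
    rcases d with _ | m
    · exact absurd (Subsingleton.elim ν 0) hν0
    · have : Fact (Module.finrank ℝ (EuclideanSpace ℝ (Fin (m + 1))) = m + 1) :=
        ⟨finrank_euclideanSpace_fin⟩
      rw [Submodule.finrank_orthogonal_span_singleton (n := m) hν0, Nat.add_sub_cancel]
  have hhaar : (Measure.hausdorffMeasure (d - 1 : ℕ) : Measure (ℝ ∙ ν)ᗮ).IsAddHaarMeasure := by
    rw [← hfin]; infer_instance
  set Φ : (ℝ ∙ ν)ᗮ → EuclideanSpace ℝ (Fin d) := fun v => (v : EuclideanSpace ℝ (Fin d)) + φ v • ν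
    with hΦdef
  have hΦ : LipschitzWith (1 + K) Φ := by
    refine LipschitzWith.add (LipschitzWith.subtype_val _) (LipschitzWith.of_dist_le_mul ?_)
    intro v w
    rw [dist_eq_norm, ← sub_smul, norm_smul, hν, mul_one, ← dist_eq_norm]
    exact hφ.dist_le_mul v w
  have hΦproj : ∀ y ∈ Metric.ball x r, y ∈ S → Φ ((ℝ ∙ ν)ᗮ.orthogonalProjectionOnto y) = y := by
    intro y hy hyS
    have h1 := (ℝ ∙ ν).starProjection_add_starProjection_orthogonal y
    rw [Submodule.starProjection_unit_singleton ℝ hν, (hgraph y hy).1 hyS, add_comm] at h1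
    exact h1
  set H : (ℝ ∙ ν)ᗮ → ℝ := fun v => ⟪a, Φ v⟫ with hHdef
  have hH : LipschitzWith (‖innerSL ℝ a‖₊ * (1 + K)) H := (innerSL ℝ a).lipschitz.comp hΦ
  set Z : Set (ℝ ∙ ν)ᗮ := {v | ¬ (H v ∈ N → HasFDerivAt H (0 : (ℝ ∙ ν)ᗮ →L[ℝ] ℝ) v)} with hZdef
  have hZ : (Measure.hausdorffMeasure (d - 1 : ℕ) : Measure (ℝ ∙ ν)ᗮ) Z = 0 :=
    hH.ae_hasFDerivAt_zero_of_mem_null _ hN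
  have hΦZ : surfaceMeasure d (Φ '' Z) = 0 := by
    have h1 := hΦ.hausdorffMeasure_image_le (d := (d - 1 : ℕ)) (Nat.cast_nonneg _) Z
    rw [hZ, mul_zero] at h1
    rw [surfaceMeasure, Measure.euclideanHausdorffMeasure_def, Measure.smul_apply,
      le_antisymm h1 zero_le, smul_zero]
  refine measure_mono_null (fun y hy => ?_) (measure_union_null hnr hΦZ)
  obtain ⟨⟨hyS, hyN⟩, hyB⟩ := hy
  set p := (ℝ ∙ ν)ᗮ.orthogonalProjectionOnto with hpdef
  have hpy := hΦproj y hyB hyS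
  -- Either `a / ‖a‖` is a rational normal at `y`, or `y` is the image of a point of the exceptional
  -- null set `Z`.
  by_cases hd : HasFDerivAt H (0 : (ℝ ∙ ν)ᗮ →L[ℝ] ℝ) (p y)
  · left
    refine ⟨hyS, ‖a‖⁻¹ • a, ⟨norm_smul_inv_norm ha0, ?_⟩, ?_⟩
    · have h1 : (fun v => H v - H (p y)) =o[𝓝 (p y)] fun v => v - p y := by
        simpa using hd.isLittleO
      have h2 := h1.comp_tendsto
        ((p.continuous.tendsto y).mono_left (nhdsWithin_le_nhds (s := S)))
      have h3 : ((fun v => v - p y) ∘ p) =O[𝓝[S] y] fun z => z - y := by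
        refine Asymptotics.IsBigO.of_bound 1 (Eventually.of_forall fun z => ?_)
        rw [one_mul, Function.comp_apply, ← map_sub]
        exact Submodule.norm_orthogonalProjectionOnto_apply_le _ _
      -- Near `y`, `H ∘ p` agrees on `S` with `⟪a, ·⟫`, so the vanishing differential of `H` is
      -- exactly tangency.
      refine ((h2.trans_isBigO h3).const_mul_left ‖a‖⁻¹).congr' ?_ EventuallyEq.rfl
      filter_upwards [self_mem_nhdsWithin,
        mem_nhdsWithin_of_mem_nhds (Metric.isOpen_ball.mem_nhds hyB)] with z hzS hzB
      simp only [Function.comp_apply, hHdef, hpy, hΦproj z hzB hzS, inner_smul_left, inner_sub_right]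
      simp [mul_sub]
    · obtain ⟨t, k, hk⟩ := ha
      refine ⟨‖a‖⁻¹ * t, k, fun i => ?_⟩
      simp [hk i, mul_assoc]
  · right
    refine ⟨p y, fun h => hd (h ?_), hpy⟩
    simp only [hHdef, hpy]
    exact hyN

/-! ### Riemann–Lebesgue and characters of the torus -/

/-- The characteristic function of a finite absolutely continuous measure vanishes at infinity. -/
theorem MeasureTheory.Measure.AbsolutelyContinuous.tendsto_integral_exp (ν : Measure ℝ)
    [IsFiniteMeasure ν] (hν : ν ≪ volume) :
    Tendsto (fun w : ℝ => ∫ t, (𝐞 (-(t * w)) : ℂ) ∂ν) (cocompact ℝ) (𝓝 0) := by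
  refine (Real.tendsto_integral_exp_smul_cocompact
    (fun t => ((ν.rnDeriv volume t).toReal : ℂ))).congr fun w => ?_
  rw [← integral_rnDeriv_smul hν]
  refine integral_congr_ae (Eventually.of_forall fun t => ?_)
  simp [Circle.smul_def, mul_comm]

theorem continuous_toTorus {d : ℕ} : Continuous (toTorus (d := d)) :=
  continuous_pi fun i => (AddCircle.continuous_mk' 1).comp (by fun_prop)

theorem mFourier_toTorus {d : ℕ} (k : Fin d → ℤ) (x : EuclideanSpace ℝ (Fin d)) :
    UnitAddTorus.mFourier k (toTorus x) =
      (𝐞 ⟪(WithLp.toLp 2 fun i => (k i : ℝ) : EuclideanSpace ℝ (Fin d)), x⟫ : ℂ) := by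
  simp only [UnitAddTorus.mFourier, toTorus, ContinuousMap.coe_mk, fourier_coe_apply,
    Real.fourierChar_apply, ← Complex.exp_sum]
  congr 1
  rw [PiLp.inner_apply]
  simp [Finset.mul_sum, Finset.sum_mul]
  refine Finset.sum_congr rfl fun i _ => ?_
  ring

instance UnitAddCircle.isProbabilityMeasure_volume : IsProbabilityMeasure (volume : Measure UnitAddCircle) :=
  ⟨by simp⟩

/-- Translation by `1 / (2 * n)` preserves the measure and flips the sign of the character. -/
theorem UnitAddCircle.integral_fourier {n : ℤ} (hn : n ≠ 0) :
    ∫ x : UnitAddCircle, fourier n x = 0 :=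
  integral_eq_zero_of_add_right_eq_neg (fourier_add_half_inv_index hn one_pos)

theorem UnitAddTorus.integral_mFourier {d : ℕ} (k : Fin d → ℤ) :
    ∫ y, UnitAddTorus.mFourier k y = if k = 0 then 1 else 0 := by
  split_ifs with hk
  · simp [hk, UnitAddTorus.mFourier_zero]
  · obtain ⟨i, hi⟩ := Function.ne_iff.1 hk
    refine (integral_fintype_prod_volume_eq_prod
      (fun i (x : UnitAddCircle) => (fourier (k i) x : ℂ))).trans ?_
    exact Finset.prod_eq_zero (Finset.mem_univ i) (UnitAddCircle.integral_fourier hi)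

theorem integrable_comp_toTorus_smul {𝕜 : Type*} [RCLike 𝕜] {d : ℕ}
    (μ : Measure (EuclideanSpace ℝ (Fin d))) [IsFiniteMeasure μ] (g : C(UnitAddTorus (Fin d), 𝕜))
    (lam : ℝ) : Integrable (fun x => g (toTorus (lam • x))) μ := by
  refine Integrable.of_bound (C := ‖g‖) ?_ (Eventually.of_forall fun x => g.norm_coe_le_norm _)
  exact (g.continuous.comp (continuous_toTorus.comp (continuous_const_smul lam))).aestronglyMeasurable

/-! ### Equidistribution of dilates -/

/-- Equidistribution of dilates of a finite measure whose projections to rational directions are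
absolutely continuous, tested against complex functions. -/
theorem tendsto_integral_comp_toTorus_smul_complex {d : ℕ} (μ : Measure (EuclideanSpace ℝ (Fin d)))
    [IsFiniteMeasure μ]
    (hμ : ∀ a : EuclideanSpace ℝ (Fin d), IsRationalVector a → a ≠ 0 →
      μ.map (fun x => ⟪a, x⟫) ≪ volume) (g : C(UnitAddTorus (Fin d), ℂ)) :
    Tendsto (fun lam : ℝ => ∫ x, g (toTorus (lam • x)) ∂μ) atTop
      (𝓝 ((∫ y, g y) * μ.real univ)) := by
  have hgi : ∀ g : C(UnitAddTorus (Fin d), ℂ), Integrable g := fun g =>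
    Integrable.of_bound (C := ‖g‖) g.continuous.aestronglyMeasurable
      (Eventually.of_forall fun x => g.norm_coe_le_norm _)
  -- The functionals `g ↦ ∫ g(λx) dμ` are Lipschitz with constant `μ univ`, uniformly in `λ`, so
  -- convergence passes to uniform limits.
  have hclosed : IsClosed {g : C(UnitAddTorus (Fin d), ℂ) |
      Tendsto (fun lam : ℝ => ∫ x, g (toTorus (lam • x)) ∂μ) atTop
        (𝓝 ((∫ y, g y) * μ.real univ))} := by
    refine Equicontinuous.isClosed_setOfPred_tendsto
      (F := fun (lam : ℝ) (g : C(UnitAddTorus (Fin d), ℂ)) => ∫ x, g (toTorus (lam • x)) ∂μ)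
      (LipschitzWith.uniformEquicontinuous _ (μ univ).toNNReal fun lam => ?_).equicontinuous ?_
    · refine LipschitzWith.of_dist_le_mul fun g₁ g₂ => ?_
      rw [dist_eq_norm, ← integral_sub (integrable_comp_toTorus_smul μ g₁ lam)
        (integrable_comp_toTorus_smul μ g₂ lam), mul_comm]
      exact norm_integral_le_of_norm_le_const (Eventually.of_forall fun x => by
        rw [← dist_eq_norm]; exact ContinuousMap.dist_apply_le_dist _)
    · refine Continuous.mul ?_ continuous_const
      refine (LipschitzWith.of_dist_le_mul (K := 1) fun g₁ g₂ => ?_).continuous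
      rw [dist_eq_norm, ← integral_sub (hgi g₁) (hgi g₂)]
      refine (norm_integral_le_of_norm_le_const (C := dist g₁ g₂) (Eventually.of_forall fun x => by
        rw [← dist_eq_norm]; exact ContinuousMap.dist_apply_le_dist _)).trans ?_
      simp
  have hspan : g ∈ closure (Submodule.span ℂ (range (UnitAddTorus.mFourier (d := Fin d))) :
      Set C(UnitAddTorus (Fin d), ℂ)) := by
    rw [← Submodule.topologicalClosure_coe, UnitAddTorus.span_mFourier_closure_eq_top]
    trivial
  refine closure_minimal (fun g hg => ?_) hclosed hspan
  refine Submodule.span_induction ?_ ?_ ?_ ?_ hg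
  · rintro _ ⟨k, rfl⟩
    rw [mem_ofPred_eq, UnitAddTorus.integral_mFourier]
    split_ifs with hk
    · simp [hk, UnitAddTorus.mFourier_zero]
    · set a : EuclideanSpace ℝ (Fin d) := WithLp.toLp 2 fun i => (k i : ℝ) with ha
      have ha0 : a ≠ 0 := fun h => hk (funext fun i => by
        have := congrArg (fun b : EuclideanSpace ℝ (Fin d) => b i) h
        simpa [ha] using this)
      have hmeas : Measurable fun x : EuclideanSpace ℝ (Fin d) => ⟪a, x⟫ := by fun_prop
      -- The frequency is `-lam`, to cancel the minus sign in the Fourier kernel.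
      have h1 := (Measure.AbsolutelyContinuous.tendsto_integral_exp _
        (hμ a ⟨1, k, fun i => by simp [ha]⟩ ha0)).comp
        (tendsto_neg_atTop_atBot.mono_right atBot_le_cocompact)
      rw [zero_mul]
      refine h1.congr fun lam => ?_
      rw [Function.comp_apply, integral_map hmeas.aemeasurable
        (Continuous.aestronglyMeasurable (by fun_prop))]
      refine integral_congr_ae (Eventually.of_forall fun x => ?_)
      simp only [mFourier_toTorus, ← ha, inner_smul_right]
      congr 2
      ring
  · simp
  · intro g₁ g₂ _ _ h₁ h₂
    rw [mem_ofPred_eq] at h₁ h₂ ⊢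
    convert h₁.add h₂ using 2 with lam
    · exact integral_add (integrable_comp_toTorus_smul μ g₁ lam)
        (integrable_comp_toTorus_smul μ g₂ lam)
    · rw [← add_mul, ← integral_add (hgi g₁) (hgi g₂)]; rfl
  · intro c g _ h
    rw [mem_ofPred_eq] at h ⊢
    convert h.const_mul c using 2 with lam
    · exact integral_const_mul c _
    · rw [← mul_assoc, ← integral_const_mul]; rfl

/-- Equidistribution of dilates of a finite measure whose projections to rational directions are
absolutely continuous. -/
theorem tendsto_integral_comp_toTorus_smul {𝕜 : Type*} [RCLike 𝕜] {d : ℕ}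
    (μ : Measure (EuclideanSpace ℝ (Fin d))) [IsFiniteMeasure μ]
    (hμ : ∀ a : EuclideanSpace ℝ (Fin d), IsRationalVector a → a ≠ 0 →
      μ.map (fun x => ⟪a, x⟫) ≪ volume) (g : C(UnitAddTorus (Fin d), 𝕜)) :
    Tendsto (fun lam : ℝ => ∫ x, g (toTorus (lam • x)) ∂μ) atTop
      (𝓝 ((∫ y, g y) * (μ.real univ : ℝ))) := by
  -- Characters are complex-valued: a real `u` is treated inside `ℂ`, and a general `𝕜` through real
  -- and imaginary parts.
  have hreal : ∀ u : C(UnitAddTorus (Fin d), ℝ),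
      Tendsto (fun lam : ℝ => ∫ x, u (toTorus (lam • x)) ∂μ) atTop
        (𝓝 ((∫ y, u y) * μ.real univ)) := by
    intro u
    have h := tendsto_integral_comp_toTorus_smul_complex μ hμ
      ((⟨Complex.ofReal, Complex.continuous_ofReal⟩ : C(ℝ, ℂ)).comp u)
    simp only [ContinuousMap.comp_apply, ContinuousMap.coe_mk, integral_complex_ofReal] at h
    rw [← Complex.ofReal_mul] at h
    exact (Complex.continuous_re.tendsto _).comp h
  have hgi : Integrable g := Integrable.of_bound (C := ‖g‖) g.continuous.aestronglyMeasurable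
      (Eventually.of_forall fun x => g.norm_coe_le_norm _)
  have hre := hreal ((⟨RCLike.re, RCLike.continuous_re⟩ : C(𝕜, ℝ)).comp g)
  have him := hreal ((⟨RCLike.im, RCLike.continuous_im⟩ : C(𝕜, ℝ)).comp g)
  have h := ((RCLike.continuous_ofReal (K := 𝕜)).tendsto _ |>.comp hre).add
    (((RCLike.continuous_ofReal (K := 𝕜)).tendsto _ |>.comp him).mul_const (RCLike.I : 𝕜))
  convert h using 2 with lam
  · simpa using (integral_re_add_im (integrable_comp_toTorus_smul μ g lam)).symm
  · have h2 := (integral_re_add_im hgi).symm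
    rw [h2]
    simp only [ContinuousMap.comp_apply, ContinuousMap.coe_mk, RCLike.ofReal_mul]
    ring

/-- Equidistribution of dilates with an integrable density. -/
theorem MeasureTheory.Integrable.tendsto_integral_comp_toTorus_smul_mul {𝕜 : Type*} [RCLike 𝕜]
    {d : ℕ} {μ : Measure (EuclideanSpace ℝ (Fin d))}
    (hμ : ∀ a : EuclideanSpace ℝ (Fin d), IsRationalVector a → a ≠ 0 →
      μ.map (fun x => ⟪a, x⟫) ≪ volume) (g : C(UnitAddTorus (Fin d), 𝕜))
    {f : EuclideanSpace ℝ (Fin d) → 𝕜} (hf : Integrable f μ) :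
    Tendsto (fun lam : ℝ => ∫ x, g (toTorus (lam • x)) * f x ∂μ) atTop
      (𝓝 ((∫ y, g y) * ∫ x, f x ∂μ)) := by
  have hint : ∀ {f : EuclideanSpace ℝ (Fin d) → 𝕜} (_ : Integrable f μ) (lam : ℝ),
      Integrable (fun x => g (toTorus (lam • x)) * f x) μ := fun hf lam =>
    hf.bdd_mul (c := ‖g‖) (g.continuous.comp
      (continuous_toTorus.comp (continuous_const_smul lam))).aestronglyMeasurable
      (Eventually.of_forall fun x => g.norm_coe_le_norm _)
  refine Integrable.induction (fun f : EuclideanSpace ℝ (Fin d) → 𝕜 =>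
    Tendsto (fun lam : ℝ => ∫ x, g (toTorus (lam • x)) * f x ∂μ) atTop
      (𝓝 ((∫ y, g y) * ∫ x, f x ∂μ))) ?_ ?_ ?_ ?_ hf
  · intro c s hs hμs
    -- The indicator is absorbed into the measure; its restriction is at most `μ`, so its
    -- projections stay absolutely continuous.
    have : IsFiniteMeasure (μ.restrict s) := ⟨by simpa using hμs⟩
    have h := (tendsto_integral_comp_toTorus_smul (μ.restrict s) (fun a ha ha0 =>
      (Measure.map_mono Measure.restrict_le_self (by fun_prop)).absolutelyContinuous.trans
        (hμ a ha ha0)) g).mul_const c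
    convert h using 2 with lam
    · rw [← integral_mul_const, ← integral_indicator hs]
      congr 1
      ext x
      by_cases hx : x ∈ s <;> simp [hx]
    · rw [integral_indicator hs, setIntegral_const, measureReal_restrict_apply_univ,
        RCLike.real_smul_eq_coe_mul, mul_assoc]
  · intro f₁ f₂ _ h₁ h₂ t₁ t₂
    convert t₁.add t₂ using 2 with lam
    · rw [← integral_add (hint h₁ lam) (hint h₂ lam)]
      simp only [Pi.add_apply, mul_add]
    · rw [← mul_add, ← integral_add h₁ h₂]; rfl
  -- Same closedness argument, now in `L¹`, with the uniform Lipschitz constant `‖g‖`.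
  · refine Equicontinuous.isClosed_setOfPred_tendsto
      (F := fun (lam : ℝ) (f : EuclideanSpace ℝ (Fin d) →₁[μ] 𝕜) =>
        ∫ x, g (toTorus (lam • x)) * f x ∂μ)
      (LipschitzWith.uniformEquicontinuous _ ‖g‖₊ fun lam => ?_).equicontinuous
      (continuous_const.mul continuous_integral)
    refine LipschitzWith.of_dist_le_mul fun f₁ f₂ => ?_
    rw [dist_eq_norm, ← integral_sub (hint (L1.integrable_coeFn f₁) lam)
      (hint (L1.integrable_coeFn f₂) lam), dist_eq_norm, L1.norm_eq_integral_norm, coe_nnnorm,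
      ← integral_const_mul]
    refine norm_integral_le_of_norm_le ((L1.integrable_coeFn _).norm.const_mul _) ?_
    filter_upwards [Lp.coeFn_sub f₁ f₂] with x hx
    rw [hx, ← mul_sub, norm_mul]
    exact mul_le_mul_of_nonneg_right (g.norm_coe_le_norm _) (norm_nonneg _)
  · intro f₁ f₂ he _ h
    rw [← integral_congr_ae he]
    refine h.congr fun lam => integral_congr_ae ?_
    filter_upwards [he] with x hx
    rw [hx]

theorem theorem2p3 {𝕜 : Type*} [RCLike 𝕜] (d : ℕ) (hd : 2 ≤ d)
    (S : Set (EuclideanSpace ℝ (Fin d))) (hS_closed : IsClosed S)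
    (hS : IsLipschitzSurface S) (hS_nonres : IsNonResonant S)
    (g : C(UnitAddTorus (Fin d), 𝕜)) (f : EuclideanSpace ℝ (Fin d) → 𝕜)
    (hf : IntegrableOn f S (surfaceMeasure d)) :
    Tendsto (fun lam : ℝ => ∫ x in S, g (toTorus (lam • x)) * f x ∂(surfaceMeasure d)) atTop
      (𝓝 ((∫ y, g y) * ∫ x in S, f x ∂(surfaceMeasure d))) := by
  refine Integrable.tendsto_integral_comp_toTorus_smul_mul (fun a ha ha0 => ?_) g hf
  refine Measure.AbsolutelyContinuous.mk fun N hNm hN => ?_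
  have hmeas : Measurable fun x : EuclideanSpace ℝ (Fin d) => ⟪a, x⟫ := by fun_prop
  rw [Measure.map_apply hmeas hNm, Measure.restrict_apply (hmeas hNm), inter_comm]
  exact hS_nonres.surfaceMeasure_inter_inner_preimage hS ha ha0 hN
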